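/- A \emph{bipartite quad-decomposition} $\Lambda$ of a connected oriented surface $\Sigma$ without boundary is a locally finite cellular decomposition of $\Sigma$ into quadrilaterals (each with four distinct vertices) with bipartite 1-skeleton, whose vertices are coloured black and white accordingly, and which is strongly regular: two different faces are disjoint, or share only one vertex, or share only one edge. Let $V(\Lambda)$ and $F(\Lambda)$ be its sets of vertices and faces. A \emph{discrete Riemann surface} $(\Sigma,\Lambda,z)$ consists of such a decomposition and, for every $Q\in F(\Lambda)$ with vertices $b_-,w_-,b_+,w_+$ in counterclockwise order ($b_\pm$ black, $w_\pm$ white), a chart $z_Q$, i.e. an orientation-preserving embedding of $Q$ onto a rectilinear quadrilateral in $\mathbb{C}$ without self-intersections, with vertices $z_Q(b_-),z_Q(w_-),z_Q(b_+),z_Q(w_+)$. It is compact if $\Sigma$ is compact. A map $f:V(\Lambda)\to V(\Lambda')$ between discrete Riemann surfaces is \emph{discrete holomorphic} if it maps black vertices to black ones and white vertices to white ones, if for every $Q\in F(\Lambda)$ there is a face $Q'\in F(\Lambda')$ such that all vertices of $Q$ are mapped to vertices of $Q'$, and if then $g=z'_{Q'}\circ f$ satisfies $$\frac{g(b_+)-g(b_-)}{z_Q(b_+)-z_Q(b_-)}=\frac{g(w_+)-g(w_-)}{z_Q(w_+)-z_Q(w_-)}.$$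 For such an $f$ and a vertex $v$, the image of the star of $v$ (the faces incident to $v$) goes a number $k\ge 0$ of times along the star of $f(v)$, preserving the orientation; put $b_f(v)=k-1$. For a face $Q$ put $b_f(Q)=1$ if $f$ is biconstant at $Q$, i.e. $f(b_-)=f(b_+)$ and $f(w_-)=f(w_+)$, and $b_f(Q)=0$ otherwise. For an integer $N>0$, $f$ is called an \emph{$N$-sheeted discrete holomorphic covering} if it is discrete holomorphic and $\sum_{v\in f^{-1}(v')}(b_f(v)+1)=N$ for all $v'\in V(\Lambda')$. \textbf{Theorem (discrete Riemann--Hurwitz formula).} Let $(\Sigma,\Lambda,z)$ and $(\Sigma',\Lambda',z')$ be compact discrete Riemann surfaces of genera $g$ and $g'$, and let $f:V(\Lambda)\to V(\Lambda')$ be an $N$-sheeted discrete holomorphic covering. Then $$g=N(g'-1)+1+\frac{b}{2},\qquad b=\sum_{v\in V(\Lambda)}b_f(v)+\sum_{Q\in F(\Lambda)}b_f(Q).$$ -/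

import Mathlib

open scoped unitInterval

/-- A bipartite quad-decomposition, given by its combinatorial data: the set `V` of vertices, the
set `F` of quadrilaterals, the colouring of the vertices, and for every quadrilateral `Q` its
vertices `b₋, w₋, b₊, w₊ = corner Q 0, corner Q 1, corner Q 2, corner Q 3` in counterclockwise
order (indices are taken modulo 4).  The axioms say that gluing the quadrilaterals along their
common edges gives a connected oriented surface without boundary, and that the resulting cell
decomposition is locally finite and strongly regular. By strong regularity and bipartiteness an
edge is determined by its two end points. -/
structure QuadDecomposition (V F : Type*) where
  black : V → Prop
  corner : F → Fin 4 → V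
  nonempty : Nonempty V
  /-- the four vertices of a quadrilateral are distinct (closed faces are embedded) -/
  corner_injective : ∀ Q, Function.Injective (corner Q)
  /-- the 1-skeleton is bipartite, and corners are listed starting with a black one -/
  black_corner : ∀ Q, black (corner Q 0) ∧ ¬ black (corner Q 1) ∧
    black (corner Q 2) ∧ ¬ black (corner Q 3)
  /-- every vertex belongs to a face -/
  exists_face : ∀ v, ∃ Q i, corner Q i = v
  /-- the orientations of the faces fit together: an oriented edge is a side of one face only -/
  oriented : ∀ Q Q' i j, corner Q i = corner Q' j → corner Q (i + 1) = corner Q' (j + 1) → Q = Q'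
  /-- no boundary: across every side of a face there is a face with the opposite side -/
  no_boundary : ∀ Q i, ∃ Q' j, corner Q' j = corner Q (i + 1) ∧ corner Q' (j + 1) = corner Q i
  /-- local finiteness -/
  locally_finite : ∀ v, {Q | ∃ i, corner Q i = v}.Finite
  /-- around each vertex, all incident faces are reached by passing again and again to the next
  face in counterclockwise order, so that they form one single cycle -/
  star_cyclic : ∀ v Q Q' i j, corner Q i = v → corner Q' j = v →
    Relation.ReflTransGen (fun R R' => ∃ a b, corner R a = v ∧ corner R' b = v ∧
      corner R (a + 3) = corner R' (b + 1)) Q Q'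
  /-- two different faces are disjoint, or share only one vertex, or share only one edge -/
  strongly_regular : ∀ Q Q', Q ≠ Q' →
    (Set.range (corner Q) ∩ Set.range (corner Q')).Subsingleton ∨
    ∃ i j, Set.range (corner Q) ∩ Set.range (corner Q') = {corner Q i, corner Q (i + 1)} ∧
      Set.range (corner Q) ∩ Set.range (corner Q') = {corner Q' j, corner Q' (j + 1)}
  /-- any two vertices are joined by a path of edges -/
  connected : ∀ v w, Relation.ReflTransGen
    (fun a b => ∃ Q i, s(a, b) = s(corner Q i, corner Q (i + 1))) v w

namespace QuadDecomposition

variable {V F : Type*} (L : QuadDecomposition V F)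

/-- The vertex `v` and the quadrilateral `Q` are incident. -/
def Incident (v : V) (Q : F) : Prop := ∃ i, L.corner Q i = v

/-- The number of quadrilaterals in the star of `v`. -/
noncomputable def degree (v : V) : ℕ := {Q | L.Incident v Q}.ncard

/-! ### The surface -/

/-- The `i`-th side of the unit square, as a path, in counterclockwise order. -/
def squareSide (i : Fin 4) (t : I) : I × I :=
  ![(t, 0), (1, t), (unitInterval.symm t, 1), (0, unitInterval.symm t)] i

/-- Identification of a common side of two faces; it is run through in opposite directions. -/
def GlueRel (p q : Σ _ : F, I × I) : Prop :=
  ∃ Q R i j t, L.corner R j = L.corner Q (i + 1) ∧ L.corner R (j + 1) = L.corner Q i ∧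
    p = ⟨Q, squareSide i t⟩ ∧ q = ⟨R, squareSide j (unitInterval.symm t)⟩

/-- The surface obtained from a disjoint union of unit squares, one for each face, by gluing them
along their common edges, with the quotient topology. -/
def Glued : Type _ := Quot L.GlueRel

instance : TopologicalSpace L.Glued := inferInstanceAs (TopologicalSpace (Quot L.GlueRel))

/-! ### Cellular homology and genus -/

/-- The edges, each oriented from its black to its white end point. -/
def Edge : Type _ := {e : V × V // L.black e.1 ∧ ¬ L.black e.2 ∧
  ∃ Q i, s(e.1, e.2) = s(L.corner Q i, L.corner Q (i + 1))}

/-- The edge `b₋w₋` of `Q`. -/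
def edge₀ (Q : F) : L.Edge := ⟨(L.corner Q 0, L.corner Q 1),
  (L.black_corner Q).1, (L.black_corner Q).2.1, Q, 0, rfl⟩

/-- The edge `b₊w₋` of `Q`. -/
def edge₁ (Q : F) : L.Edge := ⟨(L.corner Q 2, L.corner Q 1),
  (L.black_corner Q).2.2.1, (L.black_corner Q).2.1, Q, 1, Sym2.eq_swap⟩

/-- The edge `b₊w₊` of `Q`. -/
def edge₂ (Q : F) : L.Edge := ⟨(L.corner Q 2, L.corner Q 3),
  (L.black_corner Q).2.2.1, (L.black_corner Q).2.2.2, Q, 2, rfl⟩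

/-- The edge `b₋w₊` of `Q`. -/
def edge₃ (Q : F) : L.Edge := ⟨(L.corner Q 0, L.corner Q 3),
  (L.black_corner Q).1, (L.black_corner Q).2.2.2, Q, 3, Sym2.eq_swap⟩

/-- The cellular boundary of an edge: end point minus initial point. -/
noncomputable def boundary₁ : (L.Edge →₀ ℚ) →ₗ[ℚ] (V →₀ ℚ) :=
  Finsupp.linearCombination ℚ
    (fun e : L.Edge => Finsupp.single e.1.2 (1 : ℚ) - Finsupp.single e.1.1 (1 : ℚ))

/-- The cellular boundary of a face, run through counterclockwise. -/
noncomputable def boundary₂ : (F →₀ ℚ) →ₗ[ℚ] (L.Edge →₀ ℚ) :=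
  Finsupp.linearCombination ℚ
    (fun Q => Finsupp.single (L.edge₀ Q) (1 : ℚ) - Finsupp.single (L.edge₁ Q) (1 : ℚ)
      + Finsupp.single (L.edge₂ Q) (1 : ℚ) - Finsupp.single (L.edge₃ Q) (1 : ℚ))

theorem boundary₁_comp_boundary₂ : L.boundary₁ ∘ₗ L.boundary₂ = 0 := by
  ext1 Q
  apply LinearMap.ext_ring
  simp only [boundary₁, boundary₂, LinearMap.comp_apply, Finsupp.lsingle_apply,
    Finsupp.linearCombination_single, map_add, map_sub, one_smul, LinearMap.zero_apply]
  simp only [edge₀, edge₁, edge₂, edge₃]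
  abel

/-- The first homology `H₁ = ker ∂₁ / im ∂₂` with rational coefficients of the surface, computed
from its cell decomposition. -/
abbrev H1 : Type _ :=
  LinearMap.ker L.boundary₁ ⧸ (LinearMap.range L.boundary₂).submoduleOf (LinearMap.ker L.boundary₁)

/-- The genus of a (compact) surface is half its first Betti number `dim H₁`. -/
noncomputable def genus : ℚ := (Module.finrank ℚ L.H1 : ℚ) / 2

/-! ### Stars of vertices -/

/-- `n : ℤ → V` runs through the neighbours of `v` in counterclockwise order, again and again:
`n s` and `n (s + 1)` are always consecutive neighbours, i.e. there is a face with the vertices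
`v`, `n s`, a fourth one, and `n (s + 1)` in counterclockwise order. -/
def IsStarTour (v : V) (n : ℤ → V) : Prop :=
  ∀ s, ∃ Q i, L.corner Q i = v ∧ L.corner Q (i + 1) = n s ∧ L.corner Q (i + 3) = n (s + 1)

end QuadDecomposition

/-- The points `p 0, p 1, p 2, p 3` are the vertices, in counterclockwise order, of a rectilinear
quadrilateral in the plane without self-intersections: sides that are not adjacent are disjoint,
adjacent sides have only their common end point in common, and the signed area is positive. -/
structure IsQuadrilateral (p : Fin 4 → ℂ) : Prop where
  disjoint : ∀ i, Disjoint (segment ℝ (p i) (p (i + 1))) (segment ℝ (p (i + 2)) (p (i + 3)))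
  adjacent : ∀ i, segment ℝ (p i) (p (i + 1)) ∩ segment ℝ (p (i + 1)) (p (i + 2)) = {p (i + 1)}
  /-- twice the signed area is the cross product of the two diagonals -/
  positive : 0 < ((starRingEnd ℂ) (p 2 - p 0) * (p 3 - p 1)).im

/-- A discrete Riemann surface `(S, Λ, z)`: a bipartite quad-decomposition `Λ` of the surface `S`
(that is, `S` is the union of the quadrilaterals of `Λ`, glued along common edges, and has the
orientation of the quadrilaterals), together with a chart `z Q` for every quadrilateral `Q`.
Of the function `z Q` only the values at the vertices of `Q` have a meaning. -/
structure DiscreteRiemannSurface (S V F : Type*) [TopologicalSpace S] extends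
    QuadDecomposition V F where
  homeo : toQuadDecomposition.Glued ≃ₜ S
  z : F → V → ℂ
  chart : ∀ Q, IsQuadrilateral (fun i => z Q (corner Q i))

namespace DiscreteRiemannSurface

variable {S V F S' V' F' : Type*} [TopologicalSpace S] [TopologicalSpace S']
  (X : DiscreteRiemannSurface S V F) (X' : DiscreteRiemannSurface S' V' F')

/-- The discrete Cauchy-Riemann equation for `g` at the quadrilateral `Q`. -/
def CauchyRiemannAt (g : V → ℂ) (Q : F) : Prop :=
  (g (X.corner Q 2) - g (X.corner Q 0)) / (X.z Q (X.corner Q 2) - X.z Q (X.corner Q 0)) =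
  (g (X.corner Q 3) - g (X.corner Q 1)) / (X.z Q (X.corner Q 3) - X.z Q (X.corner Q 1))

/-- Discrete holomorphic mappings between discrete Riemann surfaces. -/
structure IsHolomorphic (f : V → V') : Prop where
  map_black : ∀ v, X.black v → X'.black (f v)
  map_white : ∀ v, ¬ X.black v → ¬ X'.black (f v)
  map_face : ∀ Q, ∃ Q', ∀ v, X.Incident v Q → X'.Incident (f v) Q'
  cauchyRiemann : ∀ Q Q', (∀ v, X.Incident v Q → X'.Incident (f v) Q') →
    X.CauchyRiemannAt (fun v => X'.z Q' (f v)) Q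

/-- `f` is biconstant at `Q`: constant at its black and constant at its white vertices. -/
def BiconstantAt (f : V → V') (Q : F) : Prop :=
  f (X.corner Q 0) = f (X.corner Q 2) ∧ f (X.corner Q 1) = f (X.corner Q 3)

/-- The image under `f` of the star of `v` goes `k` times along the star of `f v`, preserving the
orientation: while `s` runs once around `v` (`X.degree v` steps), the image `f (n s) = n' (h s)`
either stays or advances by one step counterclockwise, and advances by `k` full turns in total. -/
def GoesAround (f : V → V') (v : V) (k : ℕ) : Prop :=
  ∃ (n : ℤ → V) (n' : ℤ → V') (h : ℤ → ℤ), X.IsStarTour v n ∧ X'.IsStarTour (f v) n' ∧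
    (∀ s, f (n s) = n' (h s)) ∧
    (∀ s, h (s + 1) = h s ∨ h (s + 1) = h s + 1) ∧
    (∀ s, h (s + X.degree v) = h s + k * X'.degree (f v))

/-- The number of times the image of the star of `v` goes along the star of `f v` (there is exactly
one such number if `f` is discrete holomorphic). -/
noncomputable def multiplicity (f : V → V') (v : V) : ℕ := sInf {k | X.GoesAround X' f v k}

/-- The branch number of `f` at a vertex. -/
noncomputable def vertexBranchNumber (f : V → V') (v : V) : ℤ := (X.multiplicity X' f v : ℤ) - 1

open Classical in
/-- The branch number of `f` at a quadrilateral. -/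
noncomputable def faceBranchNumber (f : V → V') (Q : F) : ℤ := if X.BiconstantAt f Q then 1 else 0

/-- `f` is an `N`-sheeted discrete holomorphic covering: `f` is discrete holomorphic, `N > 0`, and
over every vertex `v'` the numbers `b_f(v) + 1` sum up to `N`. -/
structure IsSheetedCovering (f : V → V') (N : ℕ∞) : Prop where
  holomorphic : X.IsHolomorphic X' f
  pos : 0 < N
  sum_eq : ∀ v' : V', ∑' v : {v : V // f v = v'}, (X.multiplicity X' f v.1 : ℕ∞) = N

/-- The total branching number of `f` (for compact surfaces, so that there are finitely many
vertices and faces). -/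
noncomputable def totalBranchingNumber (f : V → V') : ℤ :=
  (∑ᶠ v : V, X.vertexBranchNumber X' f v) + (∑ᶠ Q : F, X.faceBranchNumber f Q)

end DiscreteRiemannSurface

/-! The formula compares two Euler counts. Each edge is run through from black to white by exactly
one side of a face, and each face has two such sides, so E = 2F. Connectedness gives rank ∂₁ = V - 1
and dim ker ∂₂ = 1; as the genus is half of dim H₁, it follows that 2g = 2 + F - V (`genus_eq`).

It remains to compare V, F with V', F'. Summing the multiplicities over all fibres gives N V', so
the vertex branch numbers add up to N V' - V. For the faces, the Cauchy-Riemann equation leaves only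
two possibilities: a face is biconstant, or it is carried onto a face with its orientation
(`IsHolomorphic.biconstantAt_or_exists_corner_eq`). Hence on a turn around v the image advances one
step at each face that is not biconstant and rests at the others, so the multiplicity of v times the
degree of f v is the number of non-biconstant faces at v (`IsHolomorphic.multiplicity_mul_degree`).
Summed over v this counts each such face four times; summed along fibres it is N times the sum of
the degrees in the target, that is 4 N F'. So N F' faces are not biconstant
(`IsSheetedCovering.card_not_biconstantAt`), and the face branch numbers add up to F - N F'. -/

namespace QuadDecomposition

variable {V F : Type*} (L : QuadDecomposition V F)

/-! ### Finiteness -/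

/-- The centre of the unit square. -/
noncomputable def squareCenter : I × I :=
  (⟨1 / 2, by norm_num, by norm_num⟩, ⟨1 / 2, by norm_num, by norm_num⟩)

theorem squareSide_ne_squareCenter (i : Fin 4) (t : I) : squareSide i t ≠ squareCenter := by
  intro h
  have h1 := congrArg (fun p : I × I => (p.1 : ℝ)) h
  have h2 := congrArg (fun p : I × I => (p.2 : ℝ)) h
  fin_cases i <;> simp [squareSide, squareCenter] at h1 h2

/-- Gluing only touches sides of squares, so the predicate "is the centre of `Q`" is constant along
`GlueRel` and descends to the quotient. -/
theorem mk_eq_mk_squareCenter_iff (p : Σ _ : F, I × I) (Q : F) :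
    Quot.mk L.GlueRel p = Quot.mk L.GlueRel ⟨Q, squareCenter⟩ ↔ p = ⟨Q, squareCenter⟩ := by
  refine ⟨fun h => ?_, fun h => by rw [h]⟩
  have key : ∀ x y, L.GlueRel x y → (x = ⟨Q, squareCenter⟩) = (y = ⟨Q, squareCenter⟩) := by
    rintro x y ⟨R, R', i, j, t, -, -, rfl, rfl⟩
    have (R : F) (i : Fin 4) (t : I) :
        (⟨R, squareSide i t⟩ : Σ _ : F, I × I) ≠ ⟨Q, squareCenter⟩ := fun h =>
      squareSide_ne_squareCenter i t (eq_of_heq (Sigma.mk.inj h).2)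
    simp [this]
  have := congrArg (Quot.lift (fun x => x = (⟨Q, squareCenter⟩ : Σ _ : F, I × I)) key) h
  exact this.mpr rfl

/-- The centres form a closed discrete set: deleting all centres but one leaves an open set, these
sets cover the surface, and a finite subcover contains only finitely many centres. -/
theorem finite_faces_of_compactSpace [CompactSpace (Quot L.GlueRel)] : Finite F := by
  let U : F → Set (Quot L.GlueRel) := fun Q =>
    {x | ∀ R, R ≠ Q → x ≠ Quot.mk L.GlueRel ⟨R, squareCenter⟩}
  have hU : ∀ Q, IsOpen (U Q) := by
    intro Q
    have : IsOpen (Quot.mk L.GlueRel ⁻¹' U Q) := by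
      rw [isOpen_sigma_iff]
      intro R
      by_cases hR : R = Q
      · convert isOpen_univ
        ext p
        simp only [U, Set.mem_preimage, Set.mem_ofPred_eq, Set.mem_univ, iff_true]
        intro R' hR' h
        rw [mk_eq_mk_squareCenter_iff] at h
        exact hR' ((Sigma.mk.inj h).1.symm.trans hR)
      · convert (isClosed_singleton (x := squareCenter)).isOpen_compl
        ext p
        simp only [U, Set.mem_preimage, Set.mem_ofPred_eq, Set.mem_compl_iff, Set.mem_singleton_iff]
        constructor
        · rintro h rfl
          exact h R hR rfl
        · intro h R' _ h'
          rw [mk_eq_mk_squareCenter_iff] at h'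
          exact h (eq_of_heq (Sigma.mk.inj h').2)
    exact this
  have hcov : (Set.univ : Set (Quot L.GlueRel)) ⊆ ⋃ Q, U Q := by
    intro x _
    rw [Set.mem_iUnion]
    by_cases h : ∃ Q, x = Quot.mk L.GlueRel ⟨Q, squareCenter⟩
    · obtain ⟨Q, rfl⟩ := h
      refine ⟨Q, fun R hR h => hR ?_⟩
      rw [mk_eq_mk_squareCenter_iff] at h
      exact (Sigma.mk.inj h).1.symm
    · push Not at h
      obtain ⟨v⟩ := L.nonempty
      obtain ⟨Q, -⟩ := L.exists_face v
      exact ⟨Q, fun R _ => h R⟩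
  obtain ⟨T, hT⟩ := isCompact_univ.elim_finite_subcover U hU hcov
  refine Set.finite_univ_iff.mp (T.finite_toSet.subset fun R _ => ?_)
  have := hT (Set.mem_univ (Quot.mk L.GlueRel ⟨R, squareCenter⟩ : (Quot L.GlueRel)))
  obtain ⟨Q, hQ, h⟩ := Set.mem_iUnion₂.mp this
  by_contra hR
  exact h R (fun e => hR (e ▸ hQ)) rfl

theorem finite_vertices (L : QuadDecomposition V F) [Finite F] : Finite V :=
  Finite.of_surjective (fun p : F × Fin 4 => L.corner p.1 p.2) fun v => by
    obtain ⟨Q, i, h⟩ := L.exists_face v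
    exact ⟨(Q, i), h⟩

/-! ### Faces at an edge -/

theorem corner_eq_corner_iff {Q : F} {i j : Fin 4} : L.corner Q i = L.corner Q j ↔ i = j :=
  (L.corner_injective Q).eq_iff

theorem black_corner_iff (Q : F) (i : Fin 4) : L.black (L.corner Q i) ↔ i = 0 ∨ i = 2 := by
  obtain ⟨h0, h1, h2, h3⟩ := L.black_corner Q
  fin_cases i <;> simp [h0, h1, h2, h3]

theorem not_black_corner_iff (Q : F) (i : Fin 4) : ¬ L.black (L.corner Q i) ↔ i = 1 ∨ i = 3 := by
  rw [black_corner_iff]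
  clear Q
  revert i
  decide

theorem edge_ext_iff {e e' : L.Edge} : e = e' ↔ e.1.1 = e'.1.1 ∧ e.1.2 = e'.1.2 :=
  Subtype.ext_iff.trans Prod.ext_iff

theorem side_injective {Q Q' : F} {i j : Fin 4} (h : L.corner Q i = L.corner Q' j)
    (h' : L.corner Q (i + 1) = L.corner Q' (j + 1)) : Q = Q' ∧ i = j := by
  obtain rfl := L.oriented _ _ _ _ h h'
  exact ⟨rfl, L.corner_injective Q h⟩

/-- Every edge is run through from black to white by a side of some face. -/
theorem exists_side_of_edge (e : L.Edge) :
    ∃ Q i, L.corner Q i = e.1.1 ∧ L.corner Q (i + 1) = e.1.2 := by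
  obtain ⟨⟨b, w⟩, hb, hw, Q, i, h⟩ := e
  rcases Sym2.eq_iff.mp h with ⟨h1, h2⟩ | ⟨h1, h2⟩
  · exact ⟨Q, i, h1.symm, h2.symm⟩
  · obtain ⟨Q', j, h3, h4⟩ := L.no_boundary Q i
    exact ⟨Q', j, h3.trans h1.symm, h4.trans h2.symm⟩

/-- Every edge is run through from white to black by a side of some face. -/
theorem exists_side_of_edge' (e : L.Edge) :
    ∃ Q i, L.corner Q i = e.1.2 ∧ L.corner Q (i + 1) = e.1.1 := by
  obtain ⟨Q, i, h1, h2⟩ := L.exists_side_of_edge e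
  obtain ⟨Q', j, h3, h4⟩ := L.no_boundary Q i
  exact ⟨Q', j, h3.trans h2, h4.trans h1⟩

/-- Sides 0 and 2 are the ones that run from black to white, and coherent orientation allows each
oriented edge on one side only. This is the source of E = 2F. -/
theorem bijective_edge₀_edge₂ : Function.Bijective (Sum.elim L.edge₀ L.edge₂) := by
  constructor
  · rintro (Q | Q) (Q' | Q') h <;> have h := Prod.mk.inj (congrArg Subtype.val h)
    · rw [(L.side_injective (i := 0) (j := 0) h.1 h.2).1]
    · exact absurd (L.side_injective (i := 0) (j := 2) h.1 h.2).2 (by decide)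
    · exact absurd (L.side_injective (i := 2) (j := 0) h.1 h.2).2 (by decide)
    · rw [(L.side_injective (i := 2) (j := 2) h.1 h.2).1]
  · intro e
    obtain ⟨Q, i, h1, h2⟩ := L.exists_side_of_edge e
    rcases (L.black_corner_iff Q i).mp (h1 ▸ e.2.1) with rfl | rfl
    · exact ⟨Sum.inl Q, Subtype.ext (Prod.ext h1 h2)⟩
    · exact ⟨Sum.inr Q, Subtype.ext (Prod.ext h1 h2)⟩

theorem natCard_edge [Finite F] : Nat.card L.Edge = 2 * Nat.card F := by
  rw [← Nat.card_eq_of_bijective _ L.bijective_edge₀_edge₂, Nat.card_sum]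
  ring

theorem finite_edge [Finite F] : Finite L.Edge :=
  Finite.of_surjective _ L.bijective_edge₀_edge₂.2

/-! ### The rank of the boundary operators -/

/-- The sum of the coefficients of a `0`-chain. -/
noncomputable def augmentation (V : Type*) : (V →₀ ℚ) →ₗ[ℚ] ℚ :=
  Finsupp.linearCombination ℚ fun _ => (1 : ℚ)

theorem augmentation_single (v : V) (c : ℚ) : augmentation V (Finsupp.single v c) = c := by
  simp [augmentation]

theorem boundary₁_single (e : L.Edge) :
    L.boundary₁ (Finsupp.single e 1) = Finsupp.single e.1.2 1 - Finsupp.single e.1.1 1 := by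
  simp [boundary₁]

theorem single_sub_single_mem_range_boundary₁ (v w : V) :
    Finsupp.single v (1 : ℚ) - Finsupp.single w 1 ∈ LinearMap.range L.boundary₁ := by
  have step : ∀ a b, (∃ Q i, s(a, b) = s(L.corner Q i, L.corner Q (i + 1))) →
      Finsupp.single a (1 : ℚ) - Finsupp.single b 1 ∈ LinearMap.range L.boundary₁ := by
    rintro a b ⟨Q, i, h⟩
    have hab : L.black a ↔ ¬ L.black b := by
      have h1 := L.black_corner_iff Q i
      have h2 := L.black_corner_iff Q (i + 1)
      have h3 : (i = 0 ∨ i = 2) ↔ ¬ (i + 1 = 0 ∨ i + 1 = 2) := by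
        clear h h1 h2
        revert i; decide
      rcases Sym2.eq_iff.mp h with ⟨rfl, rfl⟩ | ⟨rfl, rfl⟩ <;> tauto
    by_cases ha : L.black a
    · have := L.boundary₁_single ⟨(a, b), ha, hab.mp ha, Q, i, h⟩
      rw [← neg_sub, ← this]
      exact neg_mem (LinearMap.mem_range_self _ _)
    · have := L.boundary₁_single ⟨(b, a), by tauto, ha, Q, i, Sym2.eq_swap.trans h⟩
      rw [← this]
      exact LinearMap.mem_range_self _ _
  induction L.connected v w with
  | refl => simp
  | tail _ h ih => simpa using add_mem ih (step _ _ h)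

/-- By connectedness any two vertices are homologous, so every 0-chain is homologous to a multiple
of one base vertex, the factor being its augmentation. -/
theorem range_boundary₁ : LinearMap.range L.boundary₁ = LinearMap.ker (augmentation V) := by
  apply le_antisymm
  · rw [LinearMap.range_le_ker_iff]
    ext1 e
    apply LinearMap.ext_ring
    simp [boundary₁_single, augmentation_single]
  · obtain ⟨v₀⟩ := L.nonempty
    have key : ∀ x : V →₀ ℚ,
        x - augmentation V x • Finsupp.single v₀ 1 ∈ LinearMap.range L.boundary₁ := by
      intro x
      induction x using Finsupp.induction_linear with
      | zero => simp
      | add x y hx hy =>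
        rw [map_add, add_smul, add_sub_add_comm]
        exact add_mem hx hy
      | single v c =>
        have := Submodule.smul_mem _ c (L.single_sub_single_mem_range_boundary₁ v v₀)
        rw [smul_sub, Finsupp.smul_single, smul_eq_mul, mul_one] at this
        rwa [augmentation_single]
    intro x hx
    simpa [LinearMap.mem_ker.mp hx] using key x

theorem finrank_range_boundary₁ [Finite V] :
    Module.finrank ℚ (LinearMap.range L.boundary₁) + 1 = Nat.card V := by
  have := Fintype.ofFinite V
  obtain ⟨v₀⟩ := L.nonempty
  have hs : Function.Surjective (augmentation V) := fun c =>
    ⟨Finsupp.single v₀ c, augmentation_single v₀ c⟩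
  have h := LinearMap.finrank_range_add_finrank_ker (augmentation V)
  rw [LinearMap.range_eq_top.mpr hs, finrank_top, Module.finrank_self,
    Module.finrank_finsupp_self] at h
  rw [range_boundary₁, Nat.card_eq_fintype_card, ← h, add_comm]

/-- An edge lies on exactly two faces, which traverse it in opposite directions: `Q` from black to
white with sign +, `Q'` back with sign -. -/
theorem boundary₂_apply (x : F →₀ ℚ) (e : L.Edge) {Q Q' : F} {i j : Fin 4}
    (h1 : L.corner Q i = e.1.1) (h2 : L.corner Q (i + 1) = e.1.2)
    (h3 : L.corner Q' j = e.1.2) (h4 : L.corner Q' (j + 1) = e.1.1) :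
    L.boundary₂ x e = x Q - x Q' := by
  classical
  induction x using Finsupp.induction_linear with
  | zero => simp
  | add x y hx hy =>
    rw [map_add, Finsupp.add_apply, hx, hy, Finsupp.add_apply, Finsupp.add_apply]
    ring
  | single R c =>
    -- Colours restrict `i` to 0, 2 and `j` to 1, 3, which matches the signs in `boundary₂`.
    have hi := (L.black_corner_iff Q i).mp (h1 ▸ e.2.1)
    have hj := (L.not_black_corner_iff Q' j).mp (h3 ▸ e.2.2.1)
    have a0 : L.edge₀ R = e ↔ R = Q ∧ i = 0 := by
      rw [edge_ext_iff]
      constructor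
      · rintro ⟨h, h'⟩
        have := L.side_injective (i := 0) (h.trans h1.symm) (h'.trans h2.symm)
        exact ⟨this.1, this.2.symm⟩
      · rintro ⟨rfl, rfl⟩
        exact ⟨h1, h2⟩
    have a2 : L.edge₂ R = e ↔ R = Q ∧ i = 2 := by
      rw [edge_ext_iff]
      constructor
      · rintro ⟨h, h'⟩
        have := L.side_injective (i := 2) (h.trans h1.symm) (h'.trans h2.symm)
        exact ⟨this.1, this.2.symm⟩
      · rintro ⟨rfl, rfl⟩
        exact ⟨h1, h2⟩
    have a1 : L.edge₁ R = e ↔ R = Q' ∧ j = 1 := by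
      rw [edge_ext_iff]
      constructor
      · rintro ⟨h, h'⟩
        have := L.side_injective (i := 1) (h'.trans h3.symm) (h.trans h4.symm)
        exact ⟨this.1, this.2.symm⟩
      · rintro ⟨rfl, rfl⟩
        exact ⟨h4, h3⟩
    have a3 : L.edge₃ R = e ↔ R = Q' ∧ j = 3 := by
      rw [edge_ext_iff]
      constructor
      · rintro ⟨h, h'⟩
        have := L.side_injective (i := 3) (h'.trans h3.symm) (h.trans h4.symm)
        exact ⟨this.1, this.2.symm⟩
      · rintro ⟨rfl, rfl⟩
        exact ⟨h4, h3⟩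
    have hb : L.boundary₂ (Finsupp.single R c) e = c * ((if L.edge₀ R = e then 1 else 0)
        - (if L.edge₁ R = e then 1 else 0) + (if L.edge₂ R = e then 1 else 0)
        - (if L.edge₃ R = e then 1 else 0)) := by
      simp only [boundary₂, Finsupp.linearCombination_single, Finsupp.smul_apply,
        Finsupp.sub_apply, Finsupp.add_apply, Finsupp.single_apply, smul_eq_mul]
    rw [hb, Finsupp.single_apply, Finsupp.single_apply]
    simp only [a0, a1, a2, a3]
    rcases hi with rfl | rfl <;> rcases hj with rfl | rfl <;>
      by_cases hQ : R = Q <;> by_cases hQ' : R = Q' <;> simp [hQ, hQ'] <;> aesop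

end QuadDecomposition

namespace QuadDecomposition

variable {V F : Type*} (L : QuadDecomposition V F)

theorem exists_edge_of_side (Q : F) (i : Fin 4) : ∃ e : L.Edge,
    (L.corner Q i = e.1.1 ∧ L.corner Q (i + 1) = e.1.2) ∨
    (L.corner Q i = e.1.2 ∧ L.corner Q (i + 1) = e.1.1) := by
  fin_cases i
  · exact ⟨L.edge₀ Q, Or.inl ⟨rfl, rfl⟩⟩
  · exact ⟨L.edge₁ Q, Or.inr ⟨rfl, rfl⟩⟩
  · exact ⟨L.edge₂ Q, Or.inl ⟨rfl, rfl⟩⟩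
  · exact ⟨L.edge₃ Q, Or.inr ⟨rfl, rfl⟩⟩

variable {L} in
theorem apply_eq_of_mem_ker_boundary₂ {x : F →₀ ℚ} (hx : L.boundary₂ x = 0) {Q Q' : F}
    {i j : Fin 4} (h : L.corner Q' j = L.corner Q (i + 1))
    (h' : L.corner Q' (j + 1) = L.corner Q i) : x Q = x Q' := by
  obtain ⟨e, ⟨h1, h2⟩ | ⟨h1, h2⟩⟩ := L.exists_edge_of_side Q i
  · have := L.boundary₂_apply x e h1 h2 (h.trans h2) (h'.trans h1)
    rw [hx, Finsupp.zero_apply] at this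
    linarith
  · have := L.boundary₂_apply x e (h.trans h2) (h'.trans h1) h1 h2
    rw [hx, Finsupp.zero_apply] at this
    linarith

variable {L} in
-- A 2-cycle has equal coefficients on faces that share an edge. Equality spreads around each vertex
-- because its star is one cycle, and then along edge paths because the surface is connected.
theorem apply_eq_apply_of_mem_ker_boundary₂ {x : F →₀ ℚ} (hx : L.boundary₂ x = 0)
    (Q Q' : F) : x Q = x Q' := by
  have star : ∀ v R R' i j, L.corner R i = v → L.corner R' j = v → x R = x R' := by
    intro v R R' i j hi hj
    induction L.star_cyclic v R R' i j hi hj generalizing j with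
    | refl => rfl
    | tail _ h ih =>
      obtain ⟨a, b, ha, hb, hab⟩ := h
      refine (ih a ha).trans (apply_eq_of_mem_ker_boundary₂ hx (i := a + 3) (j := b) ?_ hab.symm)
      rw [hb, add_assoc, show (3 + 1 : Fin 4) = 0 from rfl, add_zero, ha]
  have path : ∀ v w, Relation.ReflTransGen
      (fun a b => ∃ Q i, s(a, b) = s(L.corner Q i, L.corner Q (i + 1))) v w →
      ∀ R R' i j, L.corner R i = v → L.corner R' j = w → x R = x R' := by
    intro v w h
    induction h with
    | refl => exact star v
    | tail _ h ih =>
      intro R R' i j hi hj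
      obtain ⟨Q, a, h⟩ := h
      rcases Sym2.eq_iff.mp h with ⟨h1, h2⟩ | ⟨h1, h2⟩
      · exact (ih R Q i a hi h1.symm).trans (star _ Q R' (a + 1) j h2.symm hj)
      · exact (ih R Q i (a + 1) hi h1.symm).trans (star _ Q R' a j h2.symm hj)
  exact path _ _ (L.connected (L.corner Q 0) (L.corner Q' 0)) Q Q' 0 0 rfl rfl

/-- The kernel is spanned by the fundamental class, the sum of all faces; it is a cycle because the
faces are coherently oriented. -/
theorem finrank_ker_boundary₂ [Finite F] : Module.finrank ℚ (LinearMap.ker L.boundary₂) = 1 := by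
  obtain ⟨v⟩ := L.nonempty
  obtain ⟨Q₀, -⟩ := L.exists_face v
  let c : F →₀ ℚ := Finsupp.equivFunOnFinite.symm fun _ => 1
  have hc : c ∈ LinearMap.ker L.boundary₂ := by
    rw [LinearMap.mem_ker]
    ext e
    obtain ⟨Q, i, h1, h2⟩ := L.exists_side_of_edge e
    obtain ⟨Q', j, h3, h4⟩ := L.exists_side_of_edge' e
    rw [L.boundary₂_apply c e h1 h2 h3 h4]
    simp [c]
  refine finrank_eq_one_iff_of_nonzero' (⟨c, hc⟩ : LinearMap.ker L.boundary₂) ?_ |>.mpr ?_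
  · intro h
    have := DFunLike.congr_fun (congrArg Subtype.val h) Q₀
    simp [c] at this
  · rintro ⟨x, hx⟩
    refine ⟨x Q₀, Subtype.ext (Finsupp.ext fun Q => ?_)⟩
    simpa [c] using apply_eq_apply_of_mem_ker_boundary₂ hx Q₀ Q

/-- Euler's formula: the quadrilaterals of a closed surface have twice as many edges as faces. -/
theorem genus_eq [Finite F] : L.genus = 1 + ((Nat.card F : ℚ) - Nat.card V) / 2 := by
  have := L.finite_vertices
  have := L.finite_edge
  have := Fintype.ofFinite F
  have := Fintype.ofFinite L.Edge
  have h1 := LinearMap.finrank_range_add_finrank_ker L.boundary₁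
  have h2 := LinearMap.finrank_range_add_finrank_ker L.boundary₂
  have h3 := L.finrank_range_boundary₁
  have h4 := L.natCard_edge
  have hle : LinearMap.range L.boundary₂ ≤ LinearMap.ker L.boundary₁ :=
    LinearMap.range_le_ker_iff.mpr L.boundary₁_comp_boundary₂
  have h5 := Submodule.finrank_quotient_add_finrank
    ((LinearMap.range L.boundary₂).submoduleOf (LinearMap.ker L.boundary₁))
  rw [(Submodule.submoduleOfEquivOfLe hle).finrank_eq] at h5
  rw [finrank_ker_boundary₂, Module.finrank_finsupp_self, ← Nat.card_eq_fintype_card] at h2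
  rw [Module.finrank_finsupp_self, ← Nat.card_eq_fintype_card, h4] at h1
  -- dim H₁ = (2F - (V - 1)) - (F - 1).
  have h6 : Module.finrank ℚ L.H1 + Nat.card V = 2 + Nat.card F := by
    unfold H1
    omega
  have h7 : (Module.finrank ℚ L.H1 : ℚ) + Nat.card V = 2 + Nat.card F := by exact_mod_cast h6
  unfold genus
  linarith

/-! ### The star of a vertex -/

/-- The faces incident to `v`. -/
abbrev Star (v : V) : Type _ := {Q : F // L.Incident v Q}

instance (v : V) : Finite (L.Star v) := L.locally_finite v

theorem natCard_star (v : V) : Nat.card (L.Star v) = L.degree v := rfl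

variable {L} {v : V}

/-- The position of `v` among the corners of a face incident to it. -/
noncomputable def Star.index (Q : L.Star v) : Fin 4 := Q.2.choose

theorem Star.corner_index (Q : L.Star v) : L.corner Q.1 Q.index = v := Q.2.choose_spec

theorem Star.index_eq (Q : L.Star v) {i : Fin 4} (h : L.corner Q.1 i = v) : Q.index = i :=
  L.corner_injective Q.1 (Q.corner_index.trans h.symm)

/-- The neighbour of `v` that comes after `v` on the boundary of the face `Q`. -/
noncomputable def Star.first (Q : L.Star v) : V := L.corner Q.1 (Q.index + 1)

/-- The neighbour of `v` that comes before `v` on the boundary of the face `Q`. -/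
noncomputable def Star.last (Q : L.Star v) : V := L.corner Q.1 (Q.index + 3)

theorem Star.first_injective : Function.Injective (Star.first : L.Star v → V) := fun Q Q' h =>
  Subtype.ext (L.side_injective (Q.corner_index.trans Q'.corner_index.symm) h).1

theorem Star.index_add_three_add_one (Q : L.Star v) : Q.index + 3 + 1 = Q.index := by
  rw [add_assoc, show (3 + 1 : Fin 4) = 0 from rfl, add_zero]

theorem Star.last_injective : Function.Injective (Star.last : L.Star v → V) := fun Q Q' h => by
  refine Subtype.ext (L.side_injective h ?_).1
  rw [index_add_three_add_one, index_add_three_add_one, corner_index, corner_index]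

theorem Star.first_ne_last (Q : L.Star v) : Q.first ≠ Q.last := fun h => by
  have := L.corner_injective _ h
  revert this
  generalize Q.index = i
  revert i
  decide

theorem Star.exists_first_eq_last (Q : L.Star v) : ∃ Q' : L.Star v, Q'.first = Q.last := by
  obtain ⟨Q', j, h1, h2⟩ := L.no_boundary Q.1 (Q.index + 3)
  rw [Q.index_add_three_add_one, Q.corner_index] at h1
  refine ⟨⟨Q', j, h1⟩, ?_⟩
  rw [first, Star.index_eq ⟨Q', j, h1⟩ h1, h2, last]

variable (L v) in
/-- The permutation of the faces around `v` that passes to the next one counterclockwise. -/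
noncomputable def next : Equiv.Perm (L.Star v) :=
  Equiv.ofBijective (fun Q => Q.exists_first_eq_last.choose) <|
    -- Surjectivity comes from local finiteness: an injective self-map of the finite star is a
    -- permutation.
    Finite.injective_iff_bijective.mp fun Q Q' h => Star.last_injective <| by
      rw [← Q.exists_first_eq_last.choose_spec, ← Q'.exists_first_eq_last.choose_spec]
      exact congrArg Star.first h

theorem first_next (Q : L.Star v) : (L.next v Q).first = Q.last :=
  Q.exists_first_eq_last.choose_spec

theorem eq_next_iff {Q Q' : L.Star v} : Q' = L.next v Q ↔ Q'.first = Q.last := by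
  rw [← first_next, Star.first_injective.eq_iff]

theorem sameCycle_next (Q Q' : L.Star v) : (L.next v).SameCycle Q Q' := by
  obtain ⟨Q', j, hj⟩ := Q'
  obtain ⟨Q, i, hi⟩ := Q
  induction L.star_cyclic v Q Q' i j hi hj generalizing j with
  | refl => exact Equiv.Perm.SameCycle.refl _ _
  | @tail R R' _ h ih =>
    obtain ⟨a, b, ha, hb, hab⟩ := h
    have h := ih a ha
    rw [← Equiv.Perm.sameCycle_apply_right] at h
    convert h
    rw [eq_next_iff, Star.first, Star.last, Star.index_eq ⟨R', j, hj⟩ hb,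
      Star.index_eq ⟨R, a, ha⟩ ha, hab]

theorem isCycleOn_next [Fintype (L.Star v)] :
    (L.next v).IsCycleOn ((Finset.univ : Finset (L.Star v)) : Set (L.Star v)) := by
  rw [Finset.coe_univ]
  exact ⟨(L.next v).bijective.bijOn_univ, fun Q _ Q' _ => sameCycle_next Q Q'⟩

/-- `next` is a single cycle through the whole star, so its orbits have period exactly the degree.
-/
theorem next_zpow_apply_eq_iff (Q : L.Star v) (s t : ℤ) :
    (L.next v ^ s) Q = (L.next v ^ t) Q ↔ (L.degree v : ℤ) ∣ s - t := by
  have := Fintype.ofFinite (L.Star v)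
  rw [← natCard_star, Nat.card_eq_fintype_card, ← Finset.card_univ,
    ← isCycleOn_next.zpow_apply_eq (Finset.mem_univ Q), sub_eq_neg_add, zpow_add, zpow_neg,
    Equiv.Perm.mul_apply, Equiv.Perm.inv_eq_iff_eq]

theorem exists_next_pow_eq (Q Q' : L.Star v) : ∃ s < L.degree v, (L.next v ^ s) Q = Q' := by
  have := Fintype.ofFinite (L.Star v)
  rw [← natCard_star, Nat.card_eq_fintype_card, ← Finset.card_univ]
  exact isCycleOn_next.exists_pow_eq (Finset.mem_univ Q) (Finset.mem_univ Q')

theorem sum_next_pow_apply {M : Type*} [AddCommMonoid M] [Fintype (L.Star v)] (Q : L.Star v)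
    (φ : L.Star v → M) :
    ∑ s ∈ Finset.range (L.degree v), φ ((L.next v ^ s) Q) = ∑ R, φ R := by
  refine Finset.sum_bij (fun s _ => (L.next v ^ s) Q) (fun _ _ => Finset.mem_univ _) ?_ ?_ ?_
  · intro s hs t ht h
    rw [← zpow_natCast, ← zpow_natCast, next_zpow_apply_eq_iff] at h
    rw [Finset.mem_range] at hs ht
    have := Int.emod_eq_emod_iff_emod_sub_eq_zero.mpr (Int.emod_eq_zero_of_dvd h)
    rw [Int.emod_eq_of_lt (by omega) (by omega), Int.emod_eq_of_lt (by omega) (by omega)] at this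
    omega
  · intro R _
    obtain ⟨s, hs, h⟩ := exists_next_pow_eq Q R
    exact ⟨s, Finset.mem_range.mpr hs, h⟩
  · intro s _
    rfl

/-- The leading neighbour determines the face, so a tour is the same as an orbit of `next`, fixed by
its starting face. -/
theorem isStarTour_iff {n : ℤ → V} :
    L.IsStarTour v n ↔ ∃ Q : L.Star v, ∀ s, n s = ((L.next v ^ s) Q).first := by
  constructor
  · intro h
    have h' : ∀ s, ∃ Q : L.Star v, Q.first = n s ∧ Q.last = n (s + 1) := by
      intro s
      obtain ⟨Q, i, h1, h2, h3⟩ := h s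
      have := Star.index_eq (⟨Q, i, h1⟩ : L.Star v) h1
      exact ⟨⟨Q, i, h1⟩, by rw [Star.first, this, h2], by rw [Star.last, this, h3]⟩
    choose R hR hR' using h'
    have step : ∀ s, R (s + 1) = L.next v (R s) := fun s => by
      rw [eq_next_iff, hR, hR']
    have : ∀ s, R s = (L.next v ^ s) (R 0) := by
      intro s
      induction s using Int.induction_on with
      | zero => rfl
      | succ s ih => rw [step, ih, add_comm, zpow_add, zpow_one, Equiv.Perm.mul_apply]
      | pred s ih =>
        have := step (-s - 1)
        rw [sub_add_cancel, ih] at this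
        rw [sub_eq_neg_add, zpow_add, zpow_neg_one, Equiv.Perm.mul_apply, this,
          Equiv.Perm.inv_def, Equiv.symm_apply_apply, neg_add_eq_sub]
    exact ⟨R 0, fun s => by rw [← this, hR]⟩
  · rintro ⟨Q, h⟩ s
    refine ⟨_, _, ((L.next v ^ s) Q).corner_index, (h s).symm, ?_⟩
    rw [h, add_comm s 1, zpow_add, zpow_one, Equiv.Perm.mul_apply, first_next]
    rfl

end QuadDecomposition

/-! ### Double counting of incidences -/

namespace QuadDecomposition

variable {V F : Type*} (L : QuadDecomposition V F)

open Classical in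
theorem sum_card_filter_incident [Fintype V] (T : Finset F) :
    ∑ v, (T.filter fun Q => L.Incident v Q).card = 4 * T.card := by
  have h := Finset.sum_card_bipartiteAbove_eq_sum_card_bipartiteBelow
    (s := (Finset.univ : Finset V)) (t := T) L.Incident
  simp only [Finset.bipartiteAbove, Finset.bipartiteBelow] at h
  rw [h, Finset.sum_const_nat fun Q _ => ?_, mul_comm]
  have : (Finset.univ.filter fun v => L.Incident v Q) = Finset.univ.image (L.corner Q) := by
    ext v
    rw [Finset.mem_filter_univ, Finset.mem_image]
    exact ⟨fun ⟨i, h⟩ => ⟨i, Finset.mem_univ i, h⟩, fun ⟨i, _, h⟩ => ⟨i, h⟩⟩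
  rw [this, Finset.card_image_of_injective _ (L.corner_injective Q), Finset.card_univ,
    Fintype.card_fin]

end QuadDecomposition

/-! ### The local form of a discrete holomorphic map at a face -/

namespace DiscreteRiemannSurface

open QuadDecomposition

variable {S V F S' V' F' : Type*} [TopologicalSpace S] [TopologicalSpace S']
  {X : DiscreteRiemannSurface S V F} {X' : DiscreteRiemannSurface S' V' F'} {f : V → V'}

theorem z_corner_two_ne (X : DiscreteRiemannSurface S V F) (Q : F) :
    X.z Q (X.corner Q 2) - X.z Q (X.corner Q 0) ≠ 0 := fun h => by
  have := (X.chart Q).positive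
  simp [h] at this

theorem z_corner_three_ne (X : DiscreteRiemannSurface S V F) (Q : F) :
    X.z Q (X.corner Q 3) - X.z Q (X.corner Q 1) ≠ 0 := fun h => by
  have := (X.chart Q).positive
  simp [h] at this

/-- Two vectors that arise from a positively oriented pair by a complex factor and its negative
are not positively oriented. -/
theorem not_pos_of_div_eq_neg_div {a b p r : ℂ} (ha : a ≠ 0) (hb : b ≠ 0)
    (hab : 0 < ((starRingEnd ℂ) a * b).im) (h : p / a = -r / b) :
    ¬ 0 < ((starRingEnd ℂ) p * r).im := by
  obtain ⟨c, hc⟩ : ∃ c, p / a = c := ⟨_, rfl⟩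
  have hp : p = c * a := (div_eq_iff ha).mp hc
  have hr : r = -(c * b) := by
    rw [hc, eq_comm, div_eq_iff hb] at h
    rw [← h, neg_neg]
  -- With p = ca and r = -cb, the cross product is multiplied by -|c|².
  have : (starRingEnd ℂ) p * r = ((-Complex.normSq c : ℝ) : ℂ) * ((starRingEnd ℂ) a * b) := by
    rw [hp, hr, map_mul, Complex.ofReal_neg, Complex.normSq_eq_conj_mul_self]
    ring
  rw [this, Complex.im_ofReal_mul, not_lt]
  exact mul_nonpos_of_nonpos_of_nonneg (neg_nonpos.mpr (Complex.normSq_nonneg c)) hab.le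

/-- A discrete holomorphic map either is biconstant at a face or maps it onto a face, preserving
the orientation. -/
theorem IsHolomorphic.biconstantAt_or_exists_corner_eq (hf : X.IsHolomorphic X' f) (Q : F) :
    X.BiconstantAt f Q ∨ ∃ Q' j, ∀ i, f (X.corner Q i) = X'.corner Q' (i + j) := by
  obtain ⟨Q', hQ'⟩ := hf.map_face Q
  suffices X.BiconstantAt f Q ∨ ∃ j, ∀ i, f (X.corner Q i) = X'.corner Q' (i + j) from
    this.imp_right fun h => ⟨Q', h⟩
  have hcr := hf.cauchyRiemann Q Q' hQ'
  unfold CauchyRiemannAt at hcr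
  have hA := X.z_corner_two_ne Q
  have hB := X.z_corner_three_ne Q
  have hP := X'.z_corner_two_ne Q'
  have hR := X'.z_corner_three_ne Q'
  have hpos := (X.chart Q).positive
  have hpos' := (X'.chart Q').positive
  choose t ht using fun i => hQ' (X.corner Q i) ⟨i, rfl⟩
  obtain ⟨b0, b1, b2, b3⟩ := X.black_corner Q
  have c0 := (X'.black_corner_iff Q' (t 0)).mp (ht 0 ▸ hf.map_black _ b0)
  have c2 := (X'.black_corner_iff Q' (t 2)).mp (ht 2 ▸ hf.map_black _ b2)
  have c1 := (X'.not_black_corner_iff Q' (t 1)).mp (ht 1 ▸ hf.map_white _ b1)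
  have c3 := (X'.not_black_corner_iff Q' (t 3)).mp (ht 3 ▸ hf.map_white _ b3)
  simp only [← ht] at hcr
  have hcr' := (div_eq_div_iff hA hB).mp hcr
  simp only [BiconstantAt, ← ht, X'.corner_eq_corner_iff]
  have aux : t = ![t 0, t 1, t 2, t 3] := by
    ext i
    fin_cases i <;> rfl
  -- Of the 16 colour-preserving placements, four are biconstant; eight collapse just one diagonal
  -- and violate Cauchy-Riemann; two are rotations by 0 or 2; the last two reverse the orientation,
  -- which the sign of the area forbids.
  rcases c0 with e0 | e0 <;> rcases c2 with e2 | e2 <;> rcases c1 with e1 | e1 <;>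
    rcases c3 with e3 | e3 <;> rw [e0, e1, e2, e3] at hcr hcr' aux <;>
    simp only [e0, e1, e2, e3]
  all_goals first
    | exact Or.inl (by decide)
    | refine Or.inr ⟨0, ?_⟩; rw [aux]; decide
    | refine Or.inr ⟨2, ?_⟩; rw [aux]; decide
    | (solve | simp [sub_ne_zero.mp hA, sub_ne_zero.mp hB, sub_ne_zero.mp hP, sub_ne_zero.mp hR,
        (sub_ne_zero.mp hP).symm, (sub_ne_zero.mp hR).symm, sub_eq_zero] at hcr')
    | refine absurd hpos' (not_pos_of_div_eq_neg_div hA hB hpos ?_); rw [hcr, neg_sub]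
    | refine absurd hpos' (not_pos_of_div_eq_neg_div hA hB hpos ?_)
      rw [← neg_sub, neg_div, hcr, ← neg_div]

end DiscreteRiemannSurface

/-! ### Sequences on the integers -/

/-- Every function on the integers is the sequence of differences of another one. -/
theorem Int.exists_apply_add_one_eq_add {G : Type*} [AddCommGroup G] (c : ℤ → G) :
    ∃ h : ℤ → G, h 0 = 0 ∧ ∀ s, h (s + 1) = h s + c s := by
  refine ⟨fun s => Int.rec (fun n => ∑ i ∈ Finset.range n, c i)
    (fun n => - ∑ i ∈ Finset.range (n + 1), c (Int.negSucc i)) s, Finset.sum_range_zero _, ?_⟩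
  rintro (n | n)
  · exact Finset.sum_range_succ _ _
  · cases n with
    | zero =>
      change ∑ i ∈ Finset.range 0, c i = - ∑ i ∈ Finset.range 1, c (Int.negSucc i) + _
      simp
    | succ n =>
      change - ∑ i ∈ Finset.range (n + 1), c (Int.negSucc i) =
        - ∑ i ∈ Finset.range (n + 1 + 1), c (Int.negSucc i) + _
      rw [Finset.sum_range_succ _ (n + 1)]
      abel

theorem Int.apply_natCast_eq_add_sum {G : Type*} [AddCommGroup G] {c h : ℤ → G}
    (hc : ∀ s, h (s + 1) = h s + c s) (n : ℕ) : h n = h 0 + ∑ i ∈ Finset.range n, c i := by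
  induction n with
  | zero => simp
  | succ n ih => rw [Nat.cast_succ, hc, ih, Finset.sum_range_succ, add_assoc]

theorem Int.forall_of_iff_add_one {p : ℤ → Prop} (h0 : p 0) (h : ∀ s, p s ↔ p (s + 1)) (s : ℤ) :
    p s := by
  induction s using Int.induction_on with
  | zero => exact h0
  | succ s ih => exact (h _).mp ih
  | pred s ih => exact (h _).mpr (by rwa [sub_add_cancel])

/-! ### The multiplicity at a vertex -/

namespace DiscreteRiemannSurface

open QuadDecomposition

variable {S V F S' V' F' : Type*} [TopologicalSpace S] [TopologicalSpace S']
  {X : DiscreteRiemannSurface S V F} {X' : DiscreteRiemannSurface S' V' F'} {f : V → V'} {v : V}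

/-- Edges go to edges, even at biconstant faces: the images lie on one face and have different
colours, hence are adjacent corners. -/
theorem IsHolomorphic.exists_first_eq (hf : X.IsHolomorphic X' f) (Q : X.Star v) :
    ∃ R : X'.Star (f v), R.first = f Q.first := by
  obtain ⟨Q', hQ'⟩ := hf.map_face Q.1
  obtain ⟨j, hj⟩ := hQ' v Q.2
  obtain ⟨k, hk⟩ := hQ' Q.first ⟨_, rfl⟩
  have hb : X'.black (f v) ↔ ¬ X'.black (f Q.first) := by
    have h1 := X.black_corner_iff Q.1 Q.index
    have h2 := X.black_corner_iff Q.1 (Q.index + 1)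
    have h3 : (Q.index = 0 ∨ Q.index = 2) ↔ ¬ (Q.index + 1 = 0 ∨ Q.index + 1 = 2) := by
      generalize Q.index = i
      revert i
      decide
    rw [Q.corner_index] at h1
    change X.black Q.first ↔ _ at h2
    have h4 := hf.map_black v
    have h5 := hf.map_white v
    have h6 := hf.map_black Q.first
    have h7 := hf.map_white Q.first
    tauto
  rw [← hj, ← hk, X'.black_corner_iff, X'.black_corner_iff] at hb
  have hjk : k = j + 1 ∨ k = j + 3 := by
    clear hj hk
    revert j k
    decide
  have hi := Star.index_eq (⟨Q', j, hj⟩ : X'.Star (f v)) hj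
  rcases hjk with rfl | rfl
  · exact ⟨⟨Q', j, hj⟩, by rw [Star.first, hi, hk]⟩
  · exact ⟨X'.next _ ⟨Q', j, hj⟩, by rw [first_next, Star.last, hi, hk]⟩

theorem BiconstantAt.first_eq_last {Q : X.Star v} (h : X.BiconstantAt f Q.1) :
    f Q.first = f Q.last := by
  rw [Star.first, Star.last]
  generalize Q.index = i
  obtain ⟨h1, h2⟩ := h
  fin_cases i
  · exact h2
  · exact h1.symm
  · exact h2.symm
  · exact h1

theorem IsHolomorphic.exists_star_of_not_biconstantAt (hf : X.IsHolomorphic X' f) {Q : X.Star v}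
    (h : ¬ X.BiconstantAt f Q.1) :
    ∃ R : X'.Star (f v), R.first = f Q.first ∧ R.last = f Q.last := by
  obtain ⟨Q', j, hj⟩ := (hf.biconstantAt_or_exists_corner_eq Q.1).resolve_left h
  have hv : X'.corner Q' (Q.index + j) = f v := by rw [← hj, Q.corner_index]
  have hi := Star.index_eq (⟨Q', _, hv⟩ : X'.Star (f v)) hv
  exact ⟨⟨Q', _, hv⟩, by rw [Star.first, hi, Star.first, hj, add_right_comm],
    by rw [Star.last, hi, Star.last, hj, add_right_comm]⟩

theorem IsHolomorphic.biconstantAt_iff (hf : X.IsHolomorphic X' f) {Q : X.Star v} :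
    X.BiconstantAt f Q.1 ↔ f Q.first = f Q.last := by
  refine ⟨BiconstantAt.first_eq_last, fun h => by_contra fun hb => ?_⟩
  obtain ⟨R, h1, h2⟩ := hf.exists_star_of_not_biconstantAt hb
  exact R.first_ne_last (h1.trans (h.trans h2.symm))

open Classical in
/-- The number of steps by which `f` advances along the star of the image at the face `Q`. -/
noncomputable def advance (X : DiscreteRiemannSurface S V F) (f : V → V') (Q : F) : ℕ :=
  if X.BiconstantAt f Q then 0 else 1

/-- Consecutive neighbours of `f v` are distinct, so each step of the lift `h` is forced: it rests
exactly at the biconstant faces. One turn around `v` then adds up the advances. -/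
theorem GoesAround.mul_degree_eq (hf : X.IsHolomorphic X' f) [Fintype (X.Star v)] {k : ℕ}
    (h : X.GoesAround X' f v k) : k * X'.degree (f v) = ∑ Q : X.Star v, X.advance f Q.1 := by
  obtain ⟨n, n', h, hn, hn', hfn, hstep, hper⟩ := h
  obtain ⟨Q, hQ⟩ := isStarTour_iff.mp hn
  obtain ⟨R, hR⟩ := isStarTour_iff.mp hn'
  have hc : ∀ s, h (s + 1) = h s + (X.advance f ((X.next v ^ s) Q).1 : ℤ) := by
    intro s
    have hlast : ((X.next v ^ s) Q).last = n (s + 1) := by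
      rw [hQ, add_comm s 1, zpow_add, zpow_one, Equiv.Perm.mul_apply, first_next]
    have hb := hf.biconstantAt_iff (Q := (X.next v ^ s) Q)
    rw [← hQ, hlast, hfn, hfn] at hb
    unfold advance
    split_ifs with hbi
    · rw [Nat.cast_zero, add_zero]
      refine (hstep s).resolve_right fun h1 => ?_
      have h2 := hb.mp hbi
      rw [h1, hR, hR, add_comm _ (1 : ℤ), zpow_add, zpow_one, Equiv.Perm.mul_apply,
        first_next] at h2
      exact Star.first_ne_last _ h2
    · rw [Nat.cast_one]
      exact (hstep s).resolve_left fun h1 => hbi (hb.mpr (by rw [h1]))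
  have h1 := Int.apply_natCast_eq_add_sum hc (X.degree v)
  have h2 := hper 0
  rw [zero_add, h1, add_right_inj] at h2
  simp only [zpow_natCast] at h2
  rw [sum_next_pow_apply Q fun Q => (X.advance f Q.1 : ℤ)] at h2
  exact_mod_cast h2.symm

/-- The lift `h` is the partial sum of the advances along an orbit of `next`. The multiplicity
exists because the image tour closes up after one turn around `v`. -/
theorem IsHolomorphic.exists_goesAround (hf : X.IsHolomorphic X' f) (v : V) :
    ∃ k, X.GoesAround X' f v k := by
  have := Fintype.ofFinite (X.Star v)
  obtain ⟨Q₀, hQ₀⟩ := X.exists_face v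
  let Q : X.Star v := ⟨Q₀, hQ₀⟩
  obtain ⟨R, hR⟩ := hf.exists_first_eq Q
  let c : ℤ → ℤ := fun s => X.advance f ((X.next v ^ s) Q).1
  obtain ⟨h, h0, hc⟩ := Int.exists_apply_add_one_eq_add c
  have hfn : ∀ s, f ((X.next v ^ s) Q).first = ((X'.next (f v) ^ h s) R).first := by
    refine Int.forall_of_iff_add_one (by rw [h0]; exact hR.symm) fun s => ?_
    rw [hc, add_comm s 1, zpow_add, zpow_one, Equiv.Perm.mul_apply, first_next]
    by_cases hb : X.BiconstantAt f ((X.next v ^ s) Q).1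
    · have : c s = 0 := by simp only [c, advance, if_pos hb, Nat.cast_zero]
      rw [this, add_zero, hb.first_eq_last]
    · have : c s = 1 := by simp only [c, advance, if_neg hb, Nat.cast_one]
      obtain ⟨T, h1, h2⟩ := hf.exists_star_of_not_biconstantAt hb
      rw [this, add_comm _ (1 : ℤ), zpow_add, zpow_one, Equiv.Perm.mul_apply, first_next, ← h1,
        ← h2, Star.first_injective.eq_iff, Star.last_injective.eq_iff]
  have hd : ∀ s : ℤ, (X.next v ^ (s + X.degree v)) Q = (X.next v ^ s) Q := fun s => by
    rw [next_zpow_apply_eq_iff, add_sub_cancel_left]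
  -- The increments `c` have period `X.degree v`, so `h` grows by a fixed amount per turn.
  have hper : ∀ s, h (s + X.degree v) = h s + h (X.degree v) := by
    refine Int.forall_of_iff_add_one (by rw [h0, zero_add, zero_add]) fun s => ?_
    have : c (s + X.degree v) = c s := by simp only [c, hd]
    rw [add_right_comm s 1, hc, hc, this, add_right_comm, add_left_inj]
  obtain ⟨m, hm⟩ : ∃ m : ℕ, h (X.degree v) = m := by
    refine ⟨∑ s ∈ Finset.range (X.degree v), X.advance f ((X.next v ^ (s : ℤ)) Q).1, ?_⟩
    rw [Int.apply_natCast_eq_add_sum hc, h0, zero_add, Nat.cast_sum]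
  -- After one turn both tours are back at their starting faces, so the total advance is a whole
  -- number of turns around `f v`.
  have hdvd : X'.degree (f v) ∣ m := by
    have h1 := hfn (0 + X.degree v)
    rw [hd, hfn, zero_add, hm, Star.first_injective.eq_iff, eq_comm, next_zpow_apply_eq_iff, h0,
      sub_zero] at h1
    exact_mod_cast h1
  obtain ⟨k, rfl⟩ := hdvd
  refine ⟨k, fun s => ((X.next v ^ s) Q).first, fun s => ((X'.next (f v) ^ s) R).first, h,
    isStarTour_iff.mpr ⟨Q, fun _ => rfl⟩, isStarTour_iff.mpr ⟨R, fun _ => rfl⟩, hfn, fun s => ?_,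
    fun s => ?_⟩
  · rw [hc]
    by_cases hb : X.BiconstantAt f ((X.next v ^ s) Q).1
    · exact Or.inl (by simp only [c, advance, if_pos hb, Nat.cast_zero, add_zero])
    · exact Or.inr (by simp only [c, advance, if_neg hb, Nat.cast_one])
  · rw [hper, hm, Nat.cast_mul, mul_comm]

open Classical in
theorem IsHolomorphic.multiplicity_mul_degree (hf : X.IsHolomorphic X' f) [Fintype F] (v : V) :
    X.multiplicity X' f v * X'.degree (f v) =
      ((Finset.univ.filter fun Q => ¬ X.BiconstantAt f Q).filter fun Q => X.Incident v Q).card := by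
  -- The set of admissible `k` is nonempty, so its infimum is attained and is not the default value
  -- 0.
  have hm : X.GoesAround X' f v (X.multiplicity X' f v) := Nat.sInf_mem (hf.exists_goesAround v)
  rw [hm.mul_degree_eq hf, Finset.filter_comm, Finset.card_filter]
  have ha : ∀ Q, X.advance f Q = if ¬ X.BiconstantAt f Q then 1 else 0 := fun Q =>
    (ite_not ..).symm
  simp only [ha]
  exact (Finset.sum_subtype (Finset.univ.filter fun Q => X.Incident v Q)
    (fun Q => by rw [Finset.mem_filter_univ]) fun Q => if ¬ X.BiconstantAt f Q then 1 else 0).symm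

open Classical in
theorem IsSheetedCovering.sum_multiplicity [Fintype V] {N : ℕ} (hf : X.IsSheetedCovering X' f N)
    (v' : V') : ∑ v with f v = v', X.multiplicity X' f v = N := by
  have h := hf.sum_eq v'
  rw [tsum_fintype, ← Finset.sum_subtype (Finset.univ.filter fun v => f v = v')
    (fun v => by rw [Finset.mem_filter_univ]) fun v => (X.multiplicity X' f v : ℕ∞)] at h
  exact_mod_cast h

open Classical in
/-- Over every face of the image lie `N` faces at which the map is not biconstant. -/
theorem IsSheetedCovering.card_not_biconstantAt [Fintype V] [Fintype F] [Fintype V'] [Fintype F']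
    {N : ℕ} (hf : X.IsSheetedCovering X' f N) :
    (Finset.univ.filter fun Q => ¬ X.BiconstantAt f Q).card = N * Fintype.card F' := by
  have h1 := X.sum_card_filter_incident (Finset.univ.filter fun Q => ¬ X.BiconstantAt f Q)
  -- The incidences of non-biconstant faces become multiplicity times degree, which can be summed
  -- fibre by fibre.
  simp only [← hf.holomorphic.multiplicity_mul_degree] at h1
  have h2 := X'.sum_card_filter_incident Finset.univ
  have h3 : ∀ v', (Finset.univ.filter fun Q => X'.Incident v' Q).card = X'.degree v' := fun v' => by
    rw [degree, Set.ncard_eq_toFinset_card', Set.toFinset_ofPred]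
  simp only [h3] at h2
  rw [← Finset.sum_fiberwise Finset.univ f] at h1
  have h4 : ∀ v', ∑ v with f v = v', X.multiplicity X' f v * X'.degree (f v) =
      N * X'.degree v' := by
    intro v'
    rw [← hf.sum_multiplicity v', Finset.sum_mul]
    exact Finset.sum_congr rfl fun v hv => by rw [(Finset.mem_filter.mp hv).2]
  rw [Finset.sum_congr rfl fun v' _ => h4 v', ← Finset.mul_sum, h2, Finset.card_univ] at h1
  linarith

theorem finite_faces (X : DiscreteRiemannSurface S V F) [CompactSpace S] : Finite F :=
  have : CompactSpace (Quot X.GlueRel) := X.homeo.symm.compactSpace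
  X.finite_faces_of_compactSpace

end DiscreteRiemannSurface

/-! ### Comparison of the Euler counts -/

/-- The discrete Riemann-Hurwitz formula. -/
theorem mainTheorem2 {S V F S' V' F' : Type*} [TopologicalSpace S] [TopologicalSpace S']
    [CompactSpace S] [CompactSpace S']
    (X : DiscreteRiemannSurface S V F) (X' : DiscreteRiemannSurface S' V' F')
    (f : V → V') (N : ℕ) (hf : X.IsSheetedCovering X' f N) :
    X.genus = N * (X'.genus - 1) + 1 + (X.totalBranchingNumber X' f : ℚ) / 2 := by
  classical
  have := X.finite_faces
  have := X'.finite_faces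
  have := X.finite_vertices
  have := X'.finite_vertices
  have := Fintype.ofFinite F
  have := Fintype.ofFinite F'
  have := Fintype.ofFinite V
  have := Fintype.ofFinite V'
  have h1 := hf.card_not_biconstantAt
  have h2 : ∑ v, X.multiplicity X' f v = N * Fintype.card V' := by
    rw [← Finset.sum_fiberwise Finset.univ f, Finset.sum_congr rfl fun v' _ => hf.sum_multiplicity v',
      Finset.sum_const, Finset.card_univ, smul_eq_mul, mul_comm]
  have h3 : ∑ Q, X.faceBranchNumber f Q + N * Fintype.card F' = Fintype.card F := by
    have := Finset.card_filter_add_card_filter_not (s := Finset.univ) fun Q => X.BiconstantAt f Q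
    rw [h1, Finset.card_univ] at this
    simp only [DiscreteRiemannSurface.faceBranchNumber, Finset.sum_boole]
    exact_mod_cast this
  have h4 : ∑ v, X.vertexBranchNumber X' f v = N * Fintype.card V' - Fintype.card V := by
    simp only [DiscreteRiemannSurface.vertexBranchNumber, Finset.sum_sub_distrib, Finset.sum_const,
      Finset.card_univ, nsmul_eq_mul, mul_one]
    rw [← Nat.cast_sum, h2, Nat.cast_mul]
  have h5 : (X.totalBranchingNumber X' f : ℚ) =
      N * Fintype.card V' - Fintype.card V + (Fintype.card F - N * Fintype.card F') := by
    rw [DiscreteRiemannSurface.totalBranchingNumber, finsum_eq_sum_of_fintype,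
      finsum_eq_sum_of_fintype, h4, eq_sub_of_add_eq h3]
    push_cast
    rfl
  rw [h5, X.genus_eq, X'.genus_eq]
  simp only [Nat.card_eq_fintype_card]
  ring
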